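/- Let $d\in\mathbb N$ and $\Omega=\{-1,1\}^{\mathbb Z^d}$ with the product topology, and let $C(\Omega)$ be the space of continuous functions $\Omega\to\mathbb R$ with the supremum norm. For a finite set $A\subset\mathbb Z^d$ put $\sigma_A=\prod_{j\in A}\sigma_j$ (with $\sigma_\emptyset=1$), and let $\nabla_i f(\sigma)=f(\sigma^i)-f(\sigma)$, where $\sigma^i$ is $\sigma$ with the spin at site $i$ flipped. Let $\mathcal B$ be a finite collection of finite subsets of $\mathbb Z^d$ and $\lambda:\mathcal B\to\mathbb R$, such that the translation-invariant finite-range flip rates $c(i,\sigma)=\sum_{B\in\mathcal B}\lambda(B)\,\sigma_{B+i}$ are nonnegative. Let $$\mathcal L f=\sum_{B\in\mathcal B}\lambda(B)\sum_{i\in\mathbb Z^d}\sigma_{B+i}\nabla_i f$$ for local $f$ (functions depending on finitely many coordinates), let $\mathcal L_{\mathcal B}$ be the closure of this operator in $C(\Omega)$, and let $(S(t))_{t\ge 0}$ be the Markov (Feller) semigroup on $C(\Omega)$ whose infinitesimal generator is $\mathcal L_{\mathcal B}$. A function $f\in C(\Omega)$ is called an analytic vector if $f$ is in the domain of $\mathcal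 L_{\mathcal B}^n$ for every $n$ and there is $t>0$ with $$\sum_{n=0}^\infty\frac{t^n}{n!}\,\|\mathcal L_{\mathcal B}^n f\|_\infty<\infty.$$ Then for every analytic vector $f$ there is $r>0$ such that for all Borel probability measures $\mu,\nu$ on $\Omega$ the map $$\psi_f:[0,\infty)\to\mathbb R,\qquad \psi_f(t)=\int S(t)f\,d\mu-\int S(t)f\,d\nu,$$ extends analytically to the set $\Sigma_r=\{z\in\mathbb C:\operatorname{dist}(z,[0,\infty))\le r\}$, that is, there is a function $F$ which is complex-analytic on a neighbourhood of each point of $\Sigma_r$ and satisfies $F(t)=\psi_f(t)$ for all $t\ge 0$. In particular, $r$ may depend on $f$ (and on the dynamics), but not on $\mu,\nu$. -/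

import Mathlib

open MeasureTheory Filter Topology
open scoped NNReal Nat

/-- The sites of the lattice `ℤ^d`. -/
abbrev Site (d : ℕ) : Type := Fin d → ℤ

/-- The σ-field on the spin values `±1`, the units of `ℤ`, is the Borel (discrete) one; hence the
product σ-field on configurations is the Borel σ-field of the product topology. -/
instance instBorelSpaceIntUnits : BorelSpace ℤˣ where
  measurable_eq := by
    rw [borel_eq_top_of_discrete, eq_top_iff]
    intro s _
    exact ⟨Units.val '' s, trivial, Set.preimage_image_eq s Units.val_injective⟩

/-- The configuration space `{-1, 1}^{ℤ^d}`, with the product of the discrete topologies and its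
Borel σ-field (the instances on the type of functions); the spin values `±1` are the units of `ℤ`. -/
abbrev Config (d : ℕ) : Type := Site d → ℤˣ

namespace SpinFlip

variable {d : ℕ}

/-- The configuration `σ` flipped at the site `i`. -/
def flip (i : Site d) (σ : Config d) : Config d := Function.update σ i (-σ i)

/-- The discrete gradient `∇ᵢ f (σ) = f (σⁱ) - f σ`. -/
def grad (i : Site d) (f : Config d → ℝ) (σ : Config d) : ℝ := f (flip i σ) - f σ

/-- The spin product `σ_A = ∏_{j ∈ A} σ_j`, equal to `1` for `A = ∅`. -/
def spinProd (A : Finset (Site d)) (σ : Config d) : ℝ := ∏ j ∈ A, ((σ j : ℤ) : ℝ)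

/-- The translated set `B + i`. -/
def translate (B : Finset (Site d)) (i : Site d) : Finset (Site d) :=
  B.map (addRightEmbedding i)

/-- A function on configurations is local if it depends on finitely many coordinates only. -/
def IsLocal (f : Config d → ℝ) : Prop :=
  ∃ D : Finset (Site d), ∀ σ η : Config d, (∀ j ∈ D, σ j = η j) → f σ = f η

/-- The operator `L_B = ∑_{i ∈ ℤ^d} σ_{B+i} ∇ᵢ`. It is only applied to local functions,
for which all but finitely many terms of the sum vanish. -/
noncomputable def blockOp (B : Finset (Site d)) (f : Config d → ℝ) (σ : Config d) : ℝ :=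
  ∑' i : Site d, spinProd (translate B i) σ * grad i f σ

/-- The operator `∑_{B ∈ 𝓑} λ(B) L_B` on local functions. -/
noncomputable def preGen (𝓑 : Finset (Finset (Site d))) (lam : Finset (Site d) → ℝ)
    (f : Config d → ℝ) (σ : Config d) : ℝ :=
  ∑ B ∈ 𝓑, lam B * blockOp B f σ

/-- The flip rate `c(i, σ) = ∑_{B ∈ 𝓑} λ(B) σ_{B+i}` of the operator `preGen 𝓑 lam`. -/
noncomputable def rate (𝓑 : Finset (Finset (Site d))) (lam : Finset (Site d) → ℝ)
    (i : Site d) (σ : Config d) : ℝ :=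
  ∑ B ∈ 𝓑, lam B * spinProd (translate B i) σ

/-- The graph of the pre-generator, whose domain is the set of local (continuous) functions. -/
def preGenGraph (𝓑 : Finset (Finset (Site d))) (lam : Finset (Site d) → ℝ) :
    Set (C(Config d, ℝ) × C(Config d, ℝ)) :=
  {p | IsLocal (p.1 : Config d → ℝ) ∧ ∀ σ, p.2 σ = preGen 𝓑 lam p.1 σ}

/-- The graph of the generator, that is, of the closure of the pre-generator in `C(Ω)` with the
supremum norm. -/
def genGraph (𝓑 : Finset (Finset (Site d))) (lam : Finset (Site d) → ℝ) :
    Set (C(Config d, ℝ) × C(Config d, ℝ)) :=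
  closure (preGenGraph 𝓑 lam)

/-- Markov (Feller) semigroups on `C(Ω)`. -/
structure IsMarkovSemigroup (S : ℝ≥0 → C(Config d, ℝ) →L[ℝ] C(Config d, ℝ)) : Prop where
  zero : ∀ f, S 0 f = f
  add : ∀ s t f, S (s + t) f = S s (S t f)
  strongly_continuous : ∀ f, Continuous fun t => S t f
  one : ∀ t, S t 1 = 1
  nonneg : ∀ t f, 0 ≤ f → 0 ≤ S t f

/-- The graph of the infinitesimal generator of a semigroup: `(f, g)` belongs to it iff
`(S(t) f - f) / t → g` uniformly as `t ↓ 0`. -/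
def semigroupGenGraph (S : ℝ≥0 → C(Config d, ℝ) →L[ℝ] C(Config d, ℝ)) :
    Set (C(Config d, ℝ) × C(Config d, ℝ)) :=
  {p | Tendsto (fun t : ℝ≥0 => (t : ℝ)⁻¹ • (S t p.1 - p.1)) (𝓝[>] 0) (𝓝 p.2)}

/-- `S` is the semigroup of the spin-flip dynamics: it is a Markov semigroup, and its infinitesimal
generator is the closure of the pre-generator. -/
structure IsSpinFlipSemigroup (𝓑 : Finset (Finset (Site d))) (lam : Finset (Site d) → ℝ)
    (S : ℝ≥0 → C(Config d, ℝ) →L[ℝ] C(Config d, ℝ)) : Prop where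
  markov : IsMarkovSemigroup S
  generator : semigroupGenGraph S = genGraph 𝓑 lam

/-- Analytic vectors of the generator `L`: all iterates `u n = Lⁿ f` exist, and
`∑ tⁿ / n! ‖Lⁿ f‖` converges for some `t > 0`. -/
def IsAnalyticVector (𝓑 : Finset (Finset (Site d))) (lam : Finset (Site d) → ℝ)
    (f : C(Config d, ℝ)) : Prop :=
  ∃ u : ℕ → C(Config d, ℝ), u 0 = f ∧ (∀ n, (u n, u (n + 1)) ∈ genGraph 𝓑 lam) ∧
    ∃ t : ℝ, 0 < t ∧ Summable fun n : ℕ => t ^ n / (n ! : ℝ) * ‖u n‖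

/-- The function `ψ_f(t) = ∫ S(t) f dμ - ∫ S(t) f dν`. -/
noncomputable def psi (S : ℝ≥0 → C(Config d, ℝ) →L[ℝ] C(Config d, ℝ)) (f : C(Config d, ℝ))
    (μ ν : Measure (Config d)) (t : ℝ≥0) : ℝ :=
  ∫ σ, S t f σ ∂μ - ∫ σ, S t f σ ∂ν

/-- The set `Σ_r = {z ∈ ℂ : dist(z, ℝ⁺) ≤ r}`, with `ℝ⁺ = [0, ∞)`. -/
def strip (r : ℝ) : Set ℂ :=
  {z : ℂ | Metric.infDist z (Complex.ofReal '' Set.Ici 0) ≤ r}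

end SpinFlip

namespace SpinFlip

open Set

/-! Let `u n` be the iterates Lⁿf and `t` a radius for which the series of tⁿ/n! ‖Lⁿf‖ converges.
Since S(p) is a contraction, S(p)Lⁿf is no larger than Lⁿf, so around every p ≥ 0 the Taylor series
of ψ_f has radius at least `t`, uniformly in p, μ and ν. By `hasSum_taylor` this series equals ψ_f
to the right of p. The resulting discs of fixed radius centred along the half-line are glued by the
identity theorem in `exists_analytic_extension_strip`. -/

/-- A Markov semigroup consists of contractions. -/
theorem IsMarkovSemigroup.norm_apply_le {d : ℕ} {S : ℝ≥0 → C(Config d, ℝ) →L[ℝ] C(Config d, ℝ)}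
    (hS : IsMarkovSemigroup S) (t : ℝ≥0) (f : C(Config d, ℝ)) : ‖S t f‖ ≤ ‖f‖ := by
  have hb : ∀ σ, |f σ| ≤ ‖f‖ := fun σ => f.norm_coe_le_norm σ
  have h1 : 0 ≤ S t (‖f‖ • 1 - f) := hS.nonneg t _ fun σ => by
    change 0 ≤ ‖f‖ * 1 - f σ
    linarith [(abs_le.1 (hb σ)).2]
  have h2 : 0 ≤ S t (‖f‖ • 1 + f) := hS.nonneg t _ fun σ => by
    change 0 ≤ ‖f‖ * 1 + f σ
    linarith [(abs_le.1 (hb σ)).1]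
  rw [map_sub, map_smul, hS.one] at h1
  rw [map_add, map_smul, hS.one] at h2
  refine (ContinuousMap.norm_le _ (norm_nonneg f)).2 fun σ => abs_le.2 ⟨?_, ?_⟩
  · have : 0 ≤ ‖f‖ * 1 + S t f σ := h2 σ
    linarith
  · have : 0 ≤ ‖f‖ * 1 - S t f σ := h1 σ
    linarith

/-- The orbit of an element of the domain of the infinitesimal generator is right
differentiable. -/
theorem IsMarkovSemigroup.hasDerivWithinAt {d : ℕ}
    {S : ℝ≥0 → C(Config d, ℝ) →L[ℝ] C(Config d, ℝ)} (hS : IsMarkovSemigroup S)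
    {f g : C(Config d, ℝ)} (hfg : (f, g) ∈ semigroupGenGraph S) {s : ℝ} (hs : 0 ≤ s) :
    HasDerivWithinAt (fun x : ℝ => S x.toNNReal f) (S s.toNNReal g) (Ici s) s := by
  rw [hasDerivWithinAt_iff_tendsto_slope, Ici_sdiff_left]
  have hsub : Tendsto (fun x : ℝ => (x - s).toNNReal) (𝓝[>] s) (𝓝[>] 0) := by
    refine tendsto_nhdsWithin_iff.2 ⟨?_, ?_⟩
    · have : Continuous fun x : ℝ => (x - s).toNNReal := by fun_prop
      simpa using (this.tendsto s).mono_left nhdsWithin_le_nhds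
    · filter_upwards [self_mem_nhdsWithin] with x hx
      exact Real.toNNReal_pos.2 (sub_pos.2 hx)
  have hlim := ((S s.toNNReal).continuous.tendsto g).comp (hfg.comp hsub)
  -- S(x) = S(s)S(x - s) turns the slope at s into S(s) applied to the difference quotient at 0.
  refine hlim.congr' ?_
  filter_upwards [self_mem_nhdsWithin] with x hx
  have hxs : 0 ≤ x - s := (sub_pos.2 hx).le
  have hx' : x.toNNReal = s.toNNReal + (x - s).toNNReal := by
    rw [← Real.toNNReal_add hs hxs]; congr 1; ring
  simp only [Function.comp_apply, slope_def_module, Real.coe_toNNReal _ hxs, map_smul, map_sub]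
  rw [hx', hS.add]

/-! ### Taylor expansion of orbits -/

/-- Taylor's formula with remainder estimate for a sequence of curves in which each is the right
derivative of the preceding one. -/
theorem norm_sub_taylor_sum_le {E : Type*} [NormedAddCommGroup E] [NormedSpace ℝ E]
    {g : ℕ → ℝ → E} (hcont : ∀ n, Continuous (g n))
    (hderiv : ∀ n, ∀ s, 0 ≤ s → HasDerivWithinAt (g n) (g (n + 1) s) (Ici s) s)
    {h : ℝ} (hh : 0 ≤ h) (N : ℕ) {M : ℝ} (hM : ∀ s, ‖g (N + 1) s‖ ≤ M) :
    ‖g 0 h - ∑ n ∈ Finset.range (N + 1), (h ^ n / (n ! : ℝ)) • g n 0‖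
      ≤ h ^ N / (N ! : ℝ) * M * h := by
  -- Move the base point s with the target h fixed: the derivative telescopes to its top term. At s
  -- = h the sum is `g 0 h`, at s = 0 it is the Taylor polynomial.
  have key : ∀ N : ℕ, ∀ s, 0 ≤ s → HasDerivWithinAt
      (fun s => ∑ n ∈ Finset.range (N + 1), ((h - s) ^ n / (n ! : ℝ)) • g n s)
      (((h - s) ^ N / (N ! : ℝ)) • g (N + 1) s) (Ici s) s := by
    intro N s hs
    induction N with
    | zero => simpa using hderiv 0 s hs
    | succ N ih =>
      simp only [Finset.sum_range_succ _ (N + 1)]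
      have h1 : HasDerivWithinAt (fun s : ℝ => (h - s) ^ (N + 1) / ((N + 1)! : ℝ))
          (-((h - s) ^ N / (N ! : ℝ))) (Ici s) s := by
        have := ((((hasDerivAt_id s).const_sub h).pow (N + 1)).div_const
          ((N + 1)! : ℝ)).hasDerivWithinAt (s := Ici s)
        refine this.congr_deriv ?_
        have : (N ! : ℝ) ≠ 0 := by positivity
        rw [Nat.factorial_succ]
        push_cast
        simp only [id]
        field_simp
      refine (ih.add (h1.smul (hderiv (N + 1) s hs))).congr_deriv ?_
      module
  have hc : Continuous
      fun s => ∑ n ∈ Finset.range (N + 1), ((h - s) ^ n / (n ! : ℝ)) • g n s := by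
    fun_prop
  have := norm_image_sub_le_of_norm_deriv_right_le_segment (a := 0) (b := h)
    (C := h ^ N / (N ! : ℝ) * M) hc.continuousOn (fun s hs => key N s hs.1) (fun s hs => by
      rw [norm_smul, Real.norm_of_nonneg (div_nonneg (pow_nonneg (by linarith [hs.2]) _)
        (by positivity))]
      have h0 : 0 ≤ h - s := by linarith [hs.2]
      have h1 : h - s ≤ h := by linarith [hs.1]
      gcongr
      exact hM s) h (right_mem_Icc.2 hh)
  simpa [Finset.sum_range_succ', zero_pow] using this

/-- The remainder of the exponential series tends to zero inside its disc of convergence. -/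
theorem tendsto_taylor_remainder {b : ℕ → ℝ} {t h : ℝ} (ht : 0 < t) (hh : 0 ≤ h) (hht : h < t)
    (hsum : Summable fun n : ℕ => t ^ n / (n ! : ℝ) * b n) :
    Tendsto (fun N : ℕ => h ^ N / (N ! : ℝ) * b (N + 1) * h) atTop (𝓝 0) := by
  have hq : ‖h / t‖ < 1 := by
    rw [Real.norm_of_nonneg (by positivity)]; exact (div_lt_one ht).2 hht
  have h1 : Tendsto (fun n : ℕ => (n : ℝ) * (h / t) ^ n) atTop (𝓝 0) :=
    tendsto_self_mul_const_pow_of_abs_lt_one hq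
  -- With n = N + 1, the remainder is n (h/t)ⁿ times the n-th term of the summable series.
  have h2 := (h1.mul hsum.tendsto_atTop_zero).comp (tendsto_add_atTop_nat 1)
  rw [mul_zero] at h2
  refine h2.congr fun N => ?_
  have : (N ! : ℝ) ≠ 0 := by positivity
  simp only [Function.comp_apply]
  rw [Nat.factorial_succ, div_pow]
  push_cast
  field_simp
  ring

/-- The orbit of an analytic vector is the sum of its Taylor series. -/
theorem IsMarkovSemigroup.hasSum_taylor {d : ℕ}
    {S : ℝ≥0 → C(Config d, ℝ) →L[ℝ] C(Config d, ℝ)} (hS : IsMarkovSemigroup S)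
    {u : ℕ → C(Config d, ℝ)} (hu : ∀ n, (u n, u (n + 1)) ∈ semigroupGenGraph S)
    {t : ℝ} (ht : 0 < t) (hsum : Summable fun n : ℕ => t ^ n / (n ! : ℝ) * ‖u n‖)
    (h : ℝ≥0) (hht : (h : ℝ) < t) :
    HasSum (fun n : ℕ => ((h : ℝ) ^ n / (n ! : ℝ)) • u n) (S h (u 0)) := by
  have hs : Summable fun n : ℕ => ((h : ℝ) ^ n / (n ! : ℝ)) • u n := by
    refine Summable.of_norm_bounded hsum fun n => ?_
    rw [norm_smul, Real.norm_of_nonneg (by positivity)]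
    gcongr
  have hN : Tendsto (fun N : ℕ =>
      S h (u 0) - ∑ n ∈ Finset.range (N + 1), ((h : ℝ) ^ n / (n ! : ℝ)) • u n)
      atTop (𝓝 0) := by
    refine squeeze_zero_norm (fun N => ?_)
      (tendsto_taylor_remainder ht h.2 hht hsum)
    have := norm_sub_taylor_sum_le (g := fun n s => S s.toNNReal (u n))
      (fun n => (hS.strongly_continuous (u n)).comp continuous_real_toNNReal)
      (fun n s hs => hS.hasDerivWithinAt (hu n) hs) h.2 N
      (fun s => hS.norm_apply_le _ (u (N + 1)))
    simpa [hS.zero] using this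
  have h2 := hs.hasSum.tendsto_sum_nat.comp (tendsto_add_atTop_nat 1)
  have h3 := (tendsto_const_nhds (x := S h (u 0))).sub h2
  have : S h (u 0) - _ = 0 := tendsto_nhds_unique h3 hN
  rw [sub_eq_zero.1 this]
  exact hs.hasSum

/-! ### Analytic continuation -/

/-- A power series whose coefficients are dominated by a convergent exponential series is analytic
in the disc of convergence. -/
theorem analyticOnNhd_tsum_exponential {a b : ℕ → ℝ} {t : ℝ} (ht : 0 < t)
    (hab : ∀ n, |a n| ≤ b n) (hsum : Summable fun n : ℕ => t ^ n / (n ! : ℝ) * b n) (p : ℂ) :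
    AnalyticOnNhd ℂ (fun z : ℂ => ∑' n : ℕ, (z - p) ^ n / (n ! : ℂ) * (a n : ℂ))
      (Metric.ball p t) := by
  refine DifferentiableOn.analyticOnNhd ?_ Metric.isOpen_ball
  refine Complex.differentiableOn_tsum_of_summable_norm hsum (fun n => ?_) Metric.isOpen_ball
    fun n z hz => ?_
  · fun_prop
  · rw [norm_mul, norm_div, norm_pow, Complex.norm_natCast, Complex.norm_real]
    have : ‖z - p‖ ≤ t := (mem_ball_iff_norm.1 hz).le
    have := hab n
    rw [← Real.norm_eq_abs] at this
    gcongr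

/-- Two functions analytic on discs of radius `t` centred on the real line which agree with a
common function to the right of their centres agree on the intersection of the discs. -/
theorem eqOn_inter_ball_of_eq_right {G₁ G₂ : ℂ → ℂ} {p q t : ℝ} {ψ : ℝ → ℂ}
    (h₁ : AnalyticOnNhd ℂ G₁ (Metric.ball (p : ℂ) t))
    (h₂ : AnalyticOnNhd ℂ G₂ (Metric.ball (q : ℂ) t))
    (e₁ : ∀ x, p ≤ x → x < p + t → G₁ x = ψ x) (e₂ : ∀ x, q ≤ x → x < q + t → G₂ x = ψ x)
    (hpq : |p - q| < t) :
    EqOn G₁ G₂ (Metric.ball (p : ℂ) t ∩ Metric.ball (q : ℂ) t) := by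
  obtain ⟨hl, hr⟩ := abs_lt.1 hpq
  have hmp : max p q < p + t := max_lt (by linarith) (by linarith)
  have hmq : max p q < q + t := max_lt (by linarith) (by linarith)
  -- `max p q` lies in both discs, and just to its right both functions equal ψ, so the identity
  -- theorem applies there.
  refine (h₁.mono inter_subset_left).eqOn_of_preconnected_of_frequently_eq
    (h₂.mono inter_subset_right)
    ((convex_ball _ _).inter (convex_ball _ _)).isPreconnected (z₀ := ((max p q : ℝ) : ℂ)) ?_ ?_
  · simp only [mem_inter_iff, Metric.mem_ball, Complex.dist_eq, ← Complex.ofReal_sub,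
      Complex.norm_real, Real.norm_eq_abs, abs_lt]
    have := le_max_left p q
    have := le_max_right p q
    refine ⟨⟨?_, ?_⟩, ?_, ?_⟩ <;> linarith
  · have hT : Tendsto (fun x : ℝ => (x : ℂ)) (𝓝[>] (max p q)) (𝓝[≠] ((max p q : ℝ) : ℂ)) := by
      refine tendsto_nhdsWithin_iff.2 ⟨?_, ?_⟩
      · exact (Complex.continuous_ofReal.tendsto _).mono_left nhdsWithin_le_nhds
      · filter_upwards [self_mem_nhdsWithin] with x hx
        simpa using (ne_of_gt hx)
    refine hT.frequently (Eventually.frequently ?_)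
    filter_upwards [Ioo_mem_nhdsGT (lt_min hmp hmq)] with x hx
    obtain ⟨hxl, hxu⟩ := hx
    rw [e₁ x ((le_max_left _ _).trans hxl.le) (hxu.trans_le (min_le_left _ _)),
      e₂ x ((le_max_right _ _).trans hxl.le) (hxu.trans_le (min_le_right _ _))]

/-- Gluing: a function on the half-line that, to the right of each point, extends analytically to a
disc of fixed radius, extends analytically to a strip. -/
theorem exists_analytic_extension_strip {ψ : ℝ → ℂ} {t : ℝ} (ht : 0 < t) {G : ℝ → ℂ → ℂ}
    (hG : ∀ p, 0 ≤ p → AnalyticOnNhd ℂ (G p) (Metric.ball (p : ℂ) t))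
    (hψ : ∀ p, 0 ≤ p → ∀ x, p ≤ x → x < p + t → G p x = ψ x) :
    ∃ F : ℂ → ℂ, AnalyticOnNhd ℂ F (strip (t / 4)) ∧ ∀ x : ℝ, 0 ≤ x → F x = ψ x := by
  classical
  -- Half radii make the choice of centre irrelevant: two such discs sharing a point have centres
  -- less than `t` apart.
  let F : ℂ → ℂ := fun z =>
    if h : ∃ p : ℝ, 0 ≤ p ∧ dist z (p : ℂ) < t / 2 then G h.choose z else 0
  have hF : ∀ p : ℝ, 0 ≤ p → ∀ z : ℂ, dist z (p : ℂ) < t / 2 → F z = G p z := by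
    intro p hp z hz
    have hex : ∃ p : ℝ, 0 ≤ p ∧ dist z (p : ℂ) < t / 2 := ⟨p, hp, hz⟩
    obtain ⟨hq0, hqz⟩ := hex.choose_spec
    simp only [F, dif_pos hex]
    refine eqOn_inter_ball_of_eq_right (hG _ hq0) (hG p hp) (hψ _ hq0) (hψ p hp) ?_
      ⟨?_, ?_⟩
    · have := dist_triangle_left ((hex.choose : ℝ) : ℂ) (p : ℂ) z
      rw [Complex.dist_eq (hex.choose : ℂ), ← Complex.ofReal_sub, Complex.norm_real,
        Real.norm_eq_abs] at this
      linarith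
    · exact Metric.mem_ball.2 (by linarith)
    · exact Metric.mem_ball.2 (by linarith)
  refine ⟨F, fun z hz => ?_, fun x hx => ?_⟩
  -- As t/4 < t/2, the closed strip is covered by the open half-radius discs.
  · have hlt : Metric.infDist z (Complex.ofReal '' Ici 0) < t / 2 :=
      lt_of_le_of_lt hz (by linarith)
    obtain ⟨_, ⟨p, hp, rfl⟩, hzp⟩ :=
      (Metric.infDist_lt_iff (nonempty_Ici.image _)).1 hlt
    have hA : AnalyticAt ℂ (G p) z := hG p hp z (Metric.mem_ball.2 (by
      have : dist z (p : ℂ) < t / 2 := hzp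
      linarith))
    refine hA.congr ?_
    filter_upwards [Metric.isOpen_ball.mem_nhds (Metric.mem_ball.2 hzp)] with w hw
    exact (hF p hp w hw).symm
  · rw [hF x hx x (by simpa using by linarith), hψ x hx x le_rfl (by linarith)]

theorem integrable_continuousMap {d : ℕ} (μ : Measure (Config d)) [IsProbabilityMeasure μ]
    (g : C(Config d, ℝ)) : Integrable (fun σ => g σ) μ :=
  g.continuous.integrable_of_hasCompactSupport (HasCompactSupport.of_compactSpace _)

/-- The functional `g ↦ ∫ g dμ - ∫ g dν` on `C(Ω)`. -/
noncomputable def integralDiff {d : ℕ} (μ ν : Measure (Config d)) [IsProbabilityMeasure μ]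
    [IsProbabilityMeasure ν] : C(Config d, ℝ) →L[ℝ] ℝ :=
  LinearMap.mkContinuous
    { toFun := fun g => ∫ σ, g σ ∂μ - ∫ σ, g σ ∂ν
      map_add' := fun g h => by
        simp only [ContinuousMap.add_apply]
        rw [integral_add (integrable_continuousMap μ g) (integrable_continuousMap μ h),
          integral_add (integrable_continuousMap ν g) (integrable_continuousMap ν h)]
        ring
      map_smul' := fun c g => by
        simp only [ContinuousMap.smul_apply, integral_smul, RingHom.id_apply, smul_sub] }
    2 fun g => by
      have hμ := norm_integral_le_of_norm_le_const (μ := μ) (f := fun σ => g σ) (C := ‖g‖)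
        (Eventually.of_forall fun σ => g.norm_coe_le_norm σ)
      have hν := norm_integral_le_of_norm_le_const (μ := ν) (f := fun σ => g σ) (C := ‖g‖)
        (Eventually.of_forall fun σ => g.norm_coe_le_norm σ)
      simp only [probReal_univ, mul_one] at hμ hν
      have := norm_sub_le (∫ σ, g σ ∂μ) (∫ σ, g σ ∂ν)
      simp only [LinearMap.coe_mk, AddHom.coe_mk]
      linarith

theorem abs_integralDiff_le {d : ℕ} (μ ν : Measure (Config d)) [IsProbabilityMeasure μ]
    [IsProbabilityMeasure ν] (g : C(Config d, ℝ)) : |integralDiff μ ν g| ≤ 2 * ‖g‖ :=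
  (integralDiff μ ν).le_of_opNorm_le (LinearMap.mkContinuous_norm_le _ zero_le_two _) g

end SpinFlip

theorem mainTheorem7 (d : ℕ)
    (𝓑 : Finset (Finset (Site d))) (lam : Finset (Site d) → ℝ)
    (hrate : ∀ (i : Site d) (σ : Config d), 0 ≤ SpinFlip.rate 𝓑 lam i σ)
    (S : ℝ≥0 → C(Config d, ℝ) →L[ℝ] C(Config d, ℝ))
    (hS : SpinFlip.IsSpinFlipSemigroup 𝓑 lam S)
    (f : C(Config d, ℝ)) (hf : SpinFlip.IsAnalyticVector 𝓑 lam f) :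
    ∃ r : ℝ, 0 < r ∧
      ∀ (μ ν : Measure (Config d)) [IsProbabilityMeasure μ] [IsProbabilityMeasure ν],
        ∃ F : ℂ → ℂ, AnalyticOnNhd ℂ F (SpinFlip.strip r) ∧
          ∀ t : ℝ≥0, F ((t : ℝ) : ℂ) = ((SpinFlip.psi S f μ ν t : ℝ) : ℂ) := by
  obtain ⟨u, rfl, hu, t, ht, hsum⟩ := hf
  rw [← hS.generator] at hu
  have hM := hS.markov
  refine ⟨t / 4, by positivity, fun μ ν _ _ => ?_⟩
  let Φ := SpinFlip.integralDiff μ ν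
  -- This bound is free of `p`; the factor 2 comes from the two probability measures.
  have hbound : ∀ (p : ℝ≥0) (n : ℕ), |Φ (S p (u n))| ≤ 2 * ‖u n‖ := fun p n =>
    (SpinFlip.abs_integralDiff_le μ ν _).trans (by gcongr; exact hM.norm_apply_le p (u n))
  have hsum2 : Summable fun n : ℕ => t ^ n / (n ! : ℝ) * (2 * ‖u n‖) :=
    (hsum.mul_left 2).congr fun n => by ring
  obtain ⟨F, hF, hFψ⟩ := SpinFlip.exists_analytic_extension_strip (t := t) ht
    (ψ := fun x => ((SpinFlip.psi S (u 0) μ ν x.toNNReal : ℝ) : ℂ))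
    (G := fun p z => ∑' n : ℕ, (z - (p : ℂ)) ^ n / (n ! : ℂ) * (Φ (S p.toNNReal (u n)) : ℂ))
    (fun p _ => SpinFlip.analyticOnNhd_tsum_exponential ht (hbound p.toNNReal) hsum2 p)
    (fun p hp x hpx hxt => by
      have hxp : 0 ≤ x - p := sub_nonneg.2 hpx
      have hT := hM.hasSum_taylor hu ht hsum (x - p).toNNReal
        (by rw [Real.coe_toNNReal _ hxp]; linarith)
      have hx : x.toNNReal = p.toNNReal + (x - p).toNNReal := by
        rw [← Real.toNNReal_add hp hxp]; congr 1; ring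
      have hsΦ := Complex.hasSum_ofReal.2 ((Φ.comp (S p.toNNReal)).hasSum hT)
      have hval : SpinFlip.psi S (u 0) μ ν x.toNNReal
          = (Φ.comp (S p.toNNReal)) (S (x - p).toNNReal (u 0)) := by
        rw [hx, ContinuousLinearMap.comp_apply, ← hM.add]
        rfl
      rw [hval, ← hsΦ.tsum_eq]
      refine tsum_congr fun n => ?_
      simp [Real.coe_toNNReal _ hxp])
  exact ⟨F, hF, fun s => by simpa using hFψ s s.2⟩
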